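/- **Setting.** A *Turing machine* $M=(Q,\Gamma,\delta,q_0,q_{halt})$ has finitely many states, one tape with squares $0,1,2,\dots$, alphabet $\Gamma=\{0,1,\sqcup,\triangleright\}$ and a total function $\delta:Q\times\Gamma\to Q\times\Gamma\times\{L,S,R\}$. The left end marker $\triangleright$ is never overwritten nor written elsewhere. On $\triangleright$ the head moves right, in every state $q\neq q_{halt}$. Moreover $\delta(q_{halt},a)=(q_{halt},a,S)$ for all $a$, and $q_{halt}$ is the only state with these transitions. On input $s\in\{0,1\}^*$ the tape is $\triangleright s_0s_1\cdots s_l\sqcup\sqcup\cdots$ and the head starts on square $0$. $M(s)=v$ means that $M$ halts with its head on square $1$ and $v$ written there. $t_M(n)$ is the maximal number of steps of $M$ on inputs of length $n$. **The theory of a computation.** Let $t$ be a constant symbol added to the language of set theory; $t_{i,j}=t(i)(j)$ is the content $(a,q,v)$ of square $j$ at time $i$ (symbol, state, and $v=1$ iff the head is there). $\mathbf T_{\langle M,s\rangle}$ is the finite sequence of formulas consisting of $\mathbf{def}_M$ followed by $\mathbf{input}_s$. Here $\mathbf{def}_M$ says that $t$ is a function on $\omega$ whose values are functions $\omega\to\Gamma\times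 Q\times\{0,1\}$, that square $0$ always contains $\triangleright$, that at each time exactly one square is being read, that each transition $\delta(q,a)=(p,c,d)$ is obeyed (one formula for each $(q,a)$), and that the initial row is $(\sqcup,q_0,0)$ exactly from some position on. $\mathbf{input}_s$ consists of the formulas $\forall j\,(j>|s|\to t_{0,j}=(\sqcup,q_0,0))$, $t_{0,0}=(\triangleright,q_0,1)$ and $t_{0,p+1}=(s_p,q_0,0)$ for $0\le p<|s|$. **Normal proofs and adjoint checkers.** A proof $\pi=\langle\varphi_0,\dots,\varphi_n\rangle$ from a finite sequence $T$ of formulas is a sequence in which each $\varphi_i$ is a logical axiom, or an axiom of ZFC, or a member of $T$, or follows from two earlier formulas by modus ponens, or is $\forall x_k\varphi_j$ with $j<i$. A *normal proof* of $M(r)=v$ is a proof from $\mathbf T_{\langle M,r\rangle}$ of $\exists i\; t_{i,1}=(v,q_{halt},1)$. A check sequence of $\pi$ records for each $i$ one of these five justifications of $\varphi_i$ (with the indices $j,k$ used). The *adjoint checker* $\mathbf{CK}_\pi$ accepts $(U,\sigma)$ iff $\sigma$ has the same length as $\pi$ and the recorded justification is correct at each position $i$ of $\sigma$, with $U$ in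 place of $T$. **The verifier.** Let $M$ be a Turing machine and $C=\{\mathbf{CK}_{\pi_0},\dots,\mathbf{CK}_{\pi_n}\}$ a finite set of adjoint checkers, where $\pi_i$ is a normal proof of $M(r_i)=v_i$ and $M(r_i)=v_i$ holds. The *$C$-generated verifier* $\mathbf F_C$ is the Turing machine that, on input $s\in\{0,1\}^*$, computes $\mathbf{CK}_{\pi_i}(\mathbf T_{\langle M,s\rangle},\pi_i)$ for $i=0,1,\dots$, one justification at a time; it outputs $1$ as soon as one of them accepts, and $0$ if none does. Since the $\pi_i$ are fixed, the verdicts on all justifications other than membership in $\mathbf T_{\langle M,s\rangle}$ are built into the finite control. To test $\varphi\in\mathbf T_{\langle M,s\rangle}$ for a member $\varphi$ of $\pi_i$, the machine compares $\varphi$ successively with $\mathbf{def}_M$, with $t_{0,0}=(\triangleright,q_0,1)$ and, reading $s$ from the left, with the formulas $t_{0,p+1}=(s_p,q_0,0)$. If it meets the first blank, it compares $\varphi$ with the formula for $|s|$. It stops the search negatively when the squares $1,\dots,|r_i|+1$ have been read without success. **Claim.** $\mathbf F_C$ halts on every input $s$ with output $1$ if $\mathbf{CK}_{\pi_i}(\mathbf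 T_{\langle M,s\rangle},\pi_i)=1$ for some $i$, and with output $0$ otherwise. Its time complexity is bounded: there is a number $K$ (depending on $M$ and $C$ only) such that $t_{\mathbf F_C}(|s|)<K$ for all $s\in\{0,1\}^*$. -/

import Mathlib

namespace CKV

/-! ## Turing machines -/

/-- The tape alphabet `{0, 1, ⊔, ▷}`. -/
inductive Sym : Type
  | bit (b : Bool)
  | blank
  | leftEnd
  deriving DecidableEq

/-- Head movements: left, stay, right. -/
inductive Dir : Type
  | L
  | S
  | R
  deriving DecidableEq

/-- A deterministic one-tape Turing machine over `{0, 1, ⊔, ▷}` with finite state set `Q`.  The left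
end marker is never overwritten, never written elsewhere, and always sends the head to the right,
except in the halting state, in which the machine does nothing. -/
structure TM (Q : Type) where
  finite : Finite Q
  δ : Q → Sym → Q × Sym × Dir
  q₀ : Q
  qhalt : Q
  left_end : ∀ q, q ≠ qhalt → (δ q Sym.leftEnd).2 = (Sym.leftEnd, Dir.R)
  not_left_end : ∀ q a, a ≠ Sym.leftEnd → (δ q a).2.1 ≠ Sym.leftEnd
  halt : ∀ a, δ qhalt a = (qhalt, a, Dir.S)
  halt_unique : ∀ q, (∀ a, δ q a = δ qhalt a) → q = qhalt

/-- A configuration: current state, head position, tape content. -/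
structure Cfg (Q : Type) where
  state : Q
  head : ℕ
  tape : ℕ → Sym

/-- The new head position. (A machine never moves left from square `0`.) -/
def Dir.move : Dir → ℕ → ℕ
  | Dir.L, h => h - 1
  | Dir.S, h => h
  | Dir.R, h => h + 1

namespace TM

variable {Q : Type}

/-- One step of computation. -/
def step (M : TM Q) (c : Cfg Q) : Cfg Q :=
  let r := M.δ c.state (c.tape c.head)
  ⟨r.1, r.2.2.move c.head, Function.update c.tape c.head r.2.1⟩

/-- The initial tape `▷ s₀ s₁ … s_l ⊔ ⊔ …`. -/
def initTape (s : List Bool) : ℕ → Sym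
  | 0 => Sym.leftEnd
  | p + 1 => match s[p]? with
    | some b => Sym.bit b
    | none => Sym.blank

/-- The initial configuration: start state, head on square `0`. -/
def init (M : TM Q) (s : List Bool) : Cfg Q := ⟨M.q₀, 0, initTape s⟩

/-- The configuration after `n` steps on input `s`. -/
def run (M : TM Q) (s : List Bool) (n : ℕ) : Cfg Q := M.step^[n] (M.init s)

/-- `M` halts on input `s`. -/
def Halts (M : TM Q) (s : List Bool) : Prop := ∃ n, (M.run s n).state = M.qhalt

/-- `M(s) = v`: at some time `M` is in its halting state, with its head on square `1`, and that
square contains `v`. -/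
def Outputs (M : TM Q) (s : List Bool) (v : Bool) : Prop :=
  ∃ n, (M.run s n).state = M.qhalt ∧ (M.run s n).head = 1 ∧ (M.run s n).tape 1 = Sym.bit v

/-- The number of steps that `M` uses on input `s` (only meaningful if `M` halts on `s`). -/
noncomputable def steps (M : TM Q) (s : List Bool) : ℕ :=
  sInf {n | (M.run s n).state = M.qhalt}

/-- The time complexity `t_M(n)`: the maximum number of steps on inputs of length `n`
(only meaningful if `M` halts on all inputs). -/
noncomputable def timeComplexity (M : TM Q) (n : ℕ) : ℕ :=
  Finset.univ.sup fun s : Fin n → Bool => M.steps (List.ofFn s)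

end TM

/-! ## First-order formulas

The language has the binary relation `∈`, equality, and one constant symbol, which stands for the
computation table `t`. -/

/-- Terms: variables `x_k` and the constant symbol `t`. -/
inductive Tm : Type
  | var (k : ℕ)
  | tab
  deriving DecidableEq

/-- Formulas. -/
inductive Fm : Type
  | eq (u w : Tm)
  | mem (u w : Tm)
  | neg (α : Fm)
  | imp (α β : Fm)
  | all (k : ℕ) (α : Fm)
  deriving DecidableEq

namespace Fm

def or (α β : Fm) : Fm := imp (neg α) β
def and (α β : Fm) : Fm := neg (imp α (neg β))
def iff (α β : Fm) : Fm := and (imp α β) (imp β α)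
def ex (k : ℕ) (α : Fm) : Fm := neg (all k (neg α))

/-- Conjunction `α₁ ∧ (α₂ ∧ …)` of a nonempty list (some tautology for the empty list). -/
def conj : List Fm → Fm
  | [] => imp (eq Tm.tab Tm.tab) (eq Tm.tab Tm.tab)
  | [α] => α
  | α :: β :: l => and α (conj (β :: l))

/-- Disjunction of a nonempty list (some contradiction for the empty list). -/
def disj : List Fm → Fm
  | [] => neg (imp (eq Tm.tab Tm.tab) (eq Tm.tab Tm.tab))
  | [α] => α
  | α :: β :: l => or α (disj (β :: l))

/-- `x_k` occurs free in the formula. -/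
def FreeIn (k : ℕ) : Fm → Prop
  | eq u w => u = Tm.var k ∨ w = Tm.var k
  | mem u w => u = Tm.var k ∨ w = Tm.var k
  | neg α => FreeIn k α
  | imp α β => FreeIn k α ∨ FreeIn k β
  | all m α => m ≠ k ∧ FreeIn k α

/-- The formula has no free variable. -/
def IsSentence (α : Fm) : Prop := ∀ k, ¬ FreeIn k α

/-- The formula is in the language of set theory, i.e. does not contain the constant `t`. -/
def IsPure : Fm → Prop
  | eq u w => u ≠ Tm.tab ∧ w ≠ Tm.tab
  | mem u w => u ≠ Tm.tab ∧ w ≠ Tm.tab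
  | neg α => IsPure α
  | imp α β => IsPure α ∧ IsPure β
  | all _ α => IsPure α

/-- `∀ x_{k₁} ∀ x_{k₂} … α`. -/
def alls (l : List ℕ) (α : Fm) : Fm := l.foldr all α

end Fm

/-- Replace the variable `x_k` by the term `u` in a term. -/
def Tm.subst (k : ℕ) (u : Tm) (w : Tm) : Tm := if w = Tm.var k then u else w

namespace Fm

/-- `α_u^{x_k}`: replace the free occurrences of `x_k` by `u`. -/
def subst (k : ℕ) (u : Tm) : Fm → Fm
  | eq w z => eq (w.subst k u) (z.subst k u)
  | mem w z => mem (w.subst k u) (z.subst k u)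
  | neg α => neg (subst k u α)
  | imp α β => imp (subst k u α) (subst k u β)
  | all m α => if m = k then all m α else all m (subst k u α)

/-- The term `u` is substitutable for `x_k` in the formula. -/
def Substitutable (k : ℕ) (u : Tm) : Fm → Prop
  | eq _ _ => True
  | mem _ _ => True
  | neg α => Substitutable k u α
  | imp α β => Substitutable k u α ∧ Substitutable k u β
  | all m α => ¬ FreeIn k (all m α) ∨ (u ≠ Tm.var m ∧ Substitutable k u α)

/-- Propositional tautologies: true under every truth assignment to all formulas that respects
negation and implication. -/
def Tautology (α : Fm) : Prop :=
  ∀ v : Fm → Prop, (∀ β, v (neg β) ↔ ¬ v β) → (∀ β γ, v (imp β γ) ↔ (v β → v γ)) → v α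

/-- `β` is obtained from the atomic formula `α` by replacing one occurrence of `x_k` by `x_m`. -/
inductive ReplaceOne (k m : ℕ) : Fm → Fm → Prop
  | eq_left (w : Tm) : ReplaceOne k m (eq (Tm.var k) w) (eq (Tm.var m) w)
  | eq_right (w : Tm) : ReplaceOne k m (eq w (Tm.var k)) (eq w (Tm.var m))
  | mem_left (w : Tm) : ReplaceOne k m (mem (Tm.var k) w) (mem (Tm.var m) w)
  | mem_right (w : Tm) : ReplaceOne k m (mem w (Tm.var k)) (mem w (Tm.var m))

end Fm

open Fm

/-- The logical axioms `Λ`. -/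
inductive LogicAxiom : Fm → Prop
  | taut (α : Fm) : Tautology α → LogicAxiom α
  | inst (k : ℕ) (u : Tm) (α : Fm) : Substitutable k u α →
      LogicAxiom (imp (all k α) (subst k u α))
  | distrib (k : ℕ) (α β : Fm) :
      LogicAxiom (imp (all k (imp α β)) (imp (all k α) (all k β)))
  | vacuous (k : ℕ) (α : Fm) : ¬ FreeIn k α → LogicAxiom (imp α (all k α))
  | refl (k : ℕ) : LogicAxiom (eq (Tm.var k) (Tm.var k))
  | leibniz (k m : ℕ) (α β : Fm) : ReplaceOne k m α β →
      LogicAxiom (imp (eq (Tm.var k) (Tm.var m)) (imp α β))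
  | exIntro (k : ℕ) (u : Tm) (α : Fm) : Substitutable k u α →
      LogicAxiom (imp (subst k u α) (ex k α))

/-! ## Set-theoretic abbreviations

`x k` is the `k`-th variable.  In the abbreviations below, the argument `b` is the index of the first
variable that may be used as a bound variable; the variables among the other arguments are to have
indices below `b`. -/

/-- The variable `x_k`. -/
abbrev x (k : ℕ) : Tm := Tm.var k

/-- `∀ x_k ∈ y, α`. -/
def allMem (k : ℕ) (y : Tm) (α : Fm) : Fm := all k (imp (mem (x k) y) α)

/-- `∃ x_k ∈ y, α`. -/
def exMem (k : ℕ) (y : Tm) (α : Fm) : Fm := ex k (and (mem (x k) y) α)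

/-- `y = ∅`. -/
def isEmpty (b : ℕ) (y : Tm) : Fm := all b (neg (mem (x b) y))

/-- `y ⊆ z`. -/
def isSubset (b : ℕ) (y z : Tm) : Fm := allMem b y (mem (x b) z)

/-- `y = z ∪ {z}`. -/
def isSucc (b : ℕ) (y z : Tm) : Fm :=
  all b (iff (mem (x b) y) (or (mem (x b) z) (eq (x b) z)))

/-- `w = {y, z}`. -/
def isUPair (b : ℕ) (w y z : Tm) : Fm :=
  all b (iff (mem (x b) w) (or (eq (x b) y) (eq (x b) z)))

/-- `w = (y, z)`, the Kuratowski pair `{{y}, {y, z}}`. -/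
def isPair (b : ℕ) (w y z : Tm) : Fm :=
  all b (iff (mem (x b) w) (or (isUPair (b + 1) (x b) y y) (isUPair (b + 1) (x b) y z)))

/-- `w = (y, z, u) = ((y, z), u)`. -/
def isTriple (b : ℕ) (w y z u : Tm) : Fm :=
  ex b (and (isPair (b + 1) (x b) y z) (isPair (b + 1) w (x b) u))

/-- `(y, z) ∈ f`. -/
def pairMem (b : ℕ) (f y z : Tm) : Fm :=
  ex b (and (isPair (b + 1) (x b) y z) (mem (x b) f))

/-- `y` contains `∅` and is closed under successor. -/
def isInductive (b : ℕ) (y : Tm) : Fm :=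
  and (exMem b y (isEmpty (b + 1) (x b)))
    (allMem b y (exMem (b + 1) y (isSucc (b + 2) (x (b + 1)) (x b))))

/-- `y = ω`, the least inductive set. -/
def isOmega (b : ℕ) (y : Tm) : Fm :=
  and (isInductive b y) (all b (imp (isInductive (b + 1) (x b)) (isSubset (b + 1) y (x b))))

/-- `y ∈ ω`. -/
def inOmega (b : ℕ) (y : Tm) : Fm := ex b (and (isOmega (b + 1) (x b)) (mem y (x b)))

/-- `∀ x_k ∈ ω, α`. -/
def allNat (k : ℕ) (α : Fm) : Fm := all k (imp (inOmega (k + 1) (x k)) α)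

/-- `∃ x_k ∈ ω, α`. -/
def exNat (k : ℕ) (α : Fm) : Fm := ex k (and (inOmega (k + 1) (x k)) α)

/-- `y = n`, for the von Neumann numeral `n`. -/
def isNum : ℕ → ℕ → Tm → Fm
  | 0, b, y => isEmpty b y
  | n + 1, b, y => ex b (and (isNum n (b + 1) (x b)) (isSucc (b + 1) y (x b)))

/-- `α` with the numeral `n` for `x_k`, i.e. `∃ x_k (x_k = n ∧ α)`. -/
def letNum (k n : ℕ) (α : Fm) : Fm := ex k (and (isNum n (k + 1) (x k)) α)

/-- `f` is a function with domain `ω`. -/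
def isFunOnOmega (b : ℕ) (f : Tm) : Fm :=
  and (allMem b f (exNat (b + 1) (ex (b + 2) (isPair (b + 3) (x b) (x (b + 1)) (x (b + 2))))))
    (allNat b (ex (b + 1) (all (b + 2)
      (iff (pairMem (b + 3) f (x b) (x (b + 2))) (eq (x (b + 2)) (x (b + 1)))))))

/-! ## The axioms of ZFC -/

/-- The axioms of ZFC before universal closure; the schemes allow parameters. -/
inductive ZFCBody : Fm → Prop
  | extensionality : ZFCBody
      (imp (all 2 (iff (mem (x 2) (x 0)) (mem (x 2) (x 1)))) (eq (x 0) (x 1)))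
  | foundation : ZFCBody
      (imp (ex 1 (mem (x 1) (x 0)))
        (exMem 1 (x 0) (neg (ex 2 (and (mem (x 2) (x 0)) (mem (x 2) (x 1)))))))
  | pairing : ZFCBody (ex 2 (isUPair 3 (x 2) (x 0) (x 1)))
  | union : ZFCBody
      (ex 1 (all 2 (iff (mem (x 2) (x 1)) (exMem 3 (x 0) (mem (x 2) (x 3))))))
  | powerset : ZFCBody (ex 1 (all 2 (iff (mem (x 2) (x 1)) (isSubset 3 (x 2) (x 0)))))
  | infinity : ZFCBody (ex 0 (isInductive 1 (x 0)))
  /-- `∃ b ∀ y (y ∈ b ↔ y ∈ a ∧ α)`. -/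
  | separation (α : Fm) (a b y : ℕ) : IsPure α → [a, b, y].Nodup → ¬ FreeIn b α →
      ZFCBody (ex b (all y (iff (mem (x y) (x b)) (and (mem (x y) (x a)) α))))
  /-- `(∀ y ∈ a ∃! z α) → ∃ b ∀ y ∈ a ∃ z ∈ b α`. -/
  | replacement (α : Fm) (a b y z w : ℕ) : IsPure α → [a, b, y, z, w].Nodup →
      ¬ FreeIn b α → ¬ FreeIn w α →
      ZFCBody (imp (allMem y (x a) (ex w (all z (iff α (eq (x z) (x w))))))
        (ex b (allMem y (x a) (exMem z (x b) α))))
  /-- Every set of nonempty pairwise disjoint sets has a transversal. -/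
  | choice : ZFCBody
      (imp
        (and (allMem 1 (x 0) (ex 2 (mem (x 2) (x 1))))
          (allMem 1 (x 0) (allMem 2 (x 0)
            (imp (ex 3 (and (mem (x 3) (x 1)) (mem (x 3) (x 2)))) (eq (x 1) (x 2))))))
        (ex 1 (allMem 2 (x 0) (ex 3 (all 4
          (iff (and (mem (x 4) (x 2)) (mem (x 4) (x 1))) (eq (x 4) (x 3))))))))

/-- The axioms of ZFC: universal closures of the above. -/
def ZFC (α : Fm) : Prop := ∃ (l : List ℕ) (β : Fm), ZFCBody β ∧ α = alls l β ∧ IsSentence α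

/-! ## Proofs and adjoint checkers

A finite theory is given as a sequence (list) of formulas. -/

/-- The searching algorithm: compare `φ` with the members of the sequence one after the other. -/
def AL (φ : Fm) : List Fm → Bool
  | [] => false
  | ψ :: T => if φ = ψ then true else AL φ T

/-- `π` is a proof of `φ` from `T` in ZFC. -/
def IsProof (T : List Fm) (π : List Fm) (φ : Fm) : Prop :=
  π.getLast? = some φ ∧ ∀ (i : ℕ) (ψ : Fm), π[i]? = some ψ →
    LogicAxiom ψ ∨ ZFC ψ ∨ ψ ∈ T ∨
    (∃ j k : ℕ, j < i ∧ k < i ∧ ∃ χ, π[k]? = some χ ∧ π[j]? = some (imp χ ψ)) ∨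
    (∃ j k : ℕ, j < i ∧ ∃ χ, π[j]? = some χ ∧ ψ = all k χ)

/-- The five types of checkers. -/
inductive Checker : Type
  | logic
  | zfc
  | hyp
  | mp (j k : ℕ)
  | gen (j k : ℕ)

open Classical in
/-- The value of the checker `g` at position `i` of the formula sequence `σ`, for the theory `U`. -/
noncomputable def Checker.eval (U σ : List Fm) (i : ℕ) (g : Checker) : Bool :=
  match σ[i]? with
  | none => false
  | some φ =>
    match g with
    | logic => decide (LogicAxiom φ)
    | zfc => decide (ZFC φ)
    | hyp => AL φ U
    | mp j k => decide (j < i ∧ k < i ∧ ∃ χ, σ[k]? = some χ ∧ σ[j]? = some (imp χ φ))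
    | gen j k => decide (j < i ∧ ∃ χ, σ[j]? = some χ ∧ φ = all k χ)

/-- `G` is a proof type (adjoint check sequence) of the proof `π` from `T`. -/
def IsProofType (T π : List Fm) (G : List Checker) : Prop :=
  G.length = π.length ∧ ∀ (i : ℕ) (g : Checker), G[i]? = some g → g.eval T π i = true

/-- The algorithm described by a check sequence `G`, on input `(U, σ)`: compare the lengths, then
compute all the checkers. -/
noncomputable def CK (G : List Checker) (U σ : List Fm) : Bool :=
  decide (σ.length = G.length) && G.zipIdx.all fun p => p.1.eval U σ p.2

/-! ## The theory of a machine with a given input -/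

/-- The set-theoretic codes of the tape symbols. -/
def Sym.code : Sym → ℕ
  | Sym.bit false => 0
  | Sym.bit true => 1
  | Sym.blank => 2
  | Sym.leftEnd => 3

/-- All tape symbols. -/
def Sym.list : List Sym := [Sym.bit false, Sym.bit true, Sym.blank, Sym.leftEnd]

/-- `t(i)(j) = w`. -/
def tabVal (b : ℕ) (i j w : Tm) : Fm :=
  ex b (and (pairMem (b + 1) Tm.tab i (x b)) (pairMem (b + 1) (x b) j w))

section Theory

variable {Q : Type} [FinEnum Q]

/-- The set-theoretic code of a state: its number in the enumeration of `Q`. -/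
def stateCode (q : Q) : ℕ := (FinEnum.equiv q : Fin (FinEnum.card Q))

/-- `w = (y, q, v)`. -/
def isSquare (b : ℕ) (w y : Tm) (q : Q) (v : Bool) : Fm :=
  letNum b (stateCode q) (letNum (b + 1) v.toNat (isTriple (b + 2) w y (x b) (x (b + 1))))

/-- `t_{i,j} = (a, q, v)`. -/
def entry (b : ℕ) (i j : Tm) (a : Sym) (q : Q) (v : Bool) : Fm :=
  ex b (and (tabVal (b + 1) i j (x b))
    (letNum (b + 1) a.code (isSquare (b + 2) (x b) (x (b + 1)) q v)))

/-- `t_{i',j} = (π_M(t_{i,j}), p, v)`, where `π_M` is the projection to the tape symbol. -/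
def copied (b : ℕ) (i' i j : Tm) (p : Q) (v : Bool) : Fm :=
  ex b (ex (b + 1) (conj
    [tabVal (b + 2) i j (x b),
     ex (b + 2) (ex (b + 3) (isTriple (b + 4) (x b) (x (b + 1)) (x (b + 2)) (x (b + 3)))),
     ex (b + 2) (and (tabVal (b + 3) i' j (x (b + 2)))
       (isSquare (b + 3) (x (b + 2)) (x (b + 1)) p v))]))

variable (Q) in
/-- `t_{i,j} ∈ A × Q × V`, for explicitly given finite `A` and `V`. -/
def entryIn (b : ℕ) (i j : Tm) (A : List Sym) (V : List Bool) : Fm :=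
  disj (A.flatMap fun a => (FinEnum.toList Q).flatMap fun q => V.map fun v => entry b i j a q v)

variable (Q) in
/-- `t ∈ Table_M`: `t` is a function on `ω` whose values are functions `ω → Γ × Q × {0,1}`. -/
def isTable : Fm :=
  conj [isFunOnOmega 0 Tm.tab,
    allNat 0 (ex 1 (and (pairMem 2 Tm.tab (x 0) (x 1)) (isFunOnOmega 2 (x 1)))),
    allNat 0 (allNat 1 (entryIn Q 2 (x 0) (x 1) Sym.list [false, true]))]

variable (Q) in
/-- `∀ i, t_{i,0} ∈ {▷} × Q × {0,1}`. -/
def leftEndMarked : Fm :=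
  allNat 0 (letNum 1 0 (entryIn Q 2 (x 0) (x 1) [Sym.leftEnd] [false, true]))

variable (Q) in
/-- `∀ i ∃ k, t_{i,k} ∈ Γ × Q × {1} ∧ ∀ j (j ≠ k → t_{i,j} ∈ Γ × Q × {0})`. -/
def oneHead : Fm :=
  allNat 0 (exNat 1 (and (entryIn Q 2 (x 0) (x 1) Sym.list [true])
    (allNat 2 (imp (neg (eq (x 2) (x 1))) (entryIn Q 3 (x 0) (x 2) Sym.list [false])))))

/-- The formula for a transition `δ(q, a) = (p, c, d)`:
`∀ i ∀ j (t_{i,j} = (a, q, 1) → …)`, where `x₀ = i`, `x₁ = j`, `x₂ = i + 1`, and, if the head moves,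
`x₃ = j - 1` or `x₃ = j + 1` is its new position. -/
def transition (q : Q) (a : Sym) (p : Q) (c : Sym) (d : Dir) : Fm :=
  allNat 0 (allNat 1 (imp (entry 2 (x 0) (x 1) a q true) (ex 2 (and (isSucc 3 (x 2) (x 0))
    (match d with
      | Dir.S => and (entry 3 (x 2) (x 1) c p true)
          (allNat 3 (imp (neg (eq (x 3) (x 1))) (copied 4 (x 2) (x 0) (x 3) p false)))
      | Dir.L => ex 3 (and (isSucc 4 (x 1) (x 3)) (moved 4))
      | Dir.R => ex 3 (and (isSucc 4 (x 3) (x 1)) (moved 4)))))))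
where
  moved (b : ℕ) : Fm := conj
    [entry b (x 2) (x 1) c p false,
     copied b (x 2) (x 0) (x 3) p true,
     allNat b (imp (and (neg (eq (x b) (x 1))) (neg (eq (x b) (x 3))))
       (copied (b + 1) (x 2) (x 0) (x b) p false))]

variable (M : TM Q)

/-- `t_{0,j} = (⊔, q₀, 0)`. -/
def initBlank (b : ℕ) (j : Tm) : Fm :=
  letNum b 0 (entry (b + 1) (x b) j Sym.blank M.q₀ false)

/-- `∃ m ((∀ j < m, t_{0,j} ≠ (⊔, q₀, 0)) ∧ (∀ j ≥ m, t_{0,j} = (⊔, q₀, 0)))`. -/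
def inputEnds : Fm :=
  exNat 0 (and (allNat 1 (imp (mem (x 1) (x 0)) (neg (initBlank M 2 (x 1)))))
    (allNat 1 (imp (neg (mem (x 1) (x 0))) (initBlank M 2 (x 1)))))

/-- The formula sequence `def_M`. -/
def defM : List Fm :=
  [isTable Q, leftEndMarked Q, oneHead Q] ++
  ((FinEnum.toList Q).flatMap fun q => Sym.list.map fun a =>
    transition q a (M.δ q a).1 (M.δ q a).2.1 (M.δ q a).2.2) ++
  [inputEnds M]

/-- `∀ j (j > n → t_{0,j} = (⊔, q₀, 0))`, where `n` is the length of the input. -/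
def inputLength (n : ℕ) : Fm :=
  allNat 0 (imp (letNum 1 n (mem (x 1) (x 0))) (initBlank M 1 (x 0)))

/-- `t_{0,0} = (▷, q₀, 1)`. -/
def inputStart : Fm := letNum 0 0 (entry 1 (x 0) (x 0) Sym.leftEnd M.q₀ true)

/-- `t_{0,p+1} = (c, q₀, 0)`: the `p`-th bit of the input is `c`. -/
def inputBit (p : ℕ) (c : Bool) : Fm :=
  letNum 0 0 (letNum 1 (p + 1) (entry 2 (x 0) (x 1) (Sym.bit c) M.q₀ false))

/-- The formula sequence `input_s`. -/
def inputM (s : List Bool) : List Fm :=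
  inputLength M s.length :: inputStart M :: s.zipIdx.map fun c => inputBit M c.2 c.1

/-- The formula sequence `T_{⟨M,s⟩}`. -/
def theory (s : List Bool) : List Fm := defM M ++ inputM M s

/-- `∃ i, t_{i,1} = (v, q_halt, 1)`. -/
def outputIs (v : Bool) : Fm :=
  exNat 0 (letNum 1 1 (entry 2 (x 0) (x 1) (Sym.bit v) M.qhalt true))

/-- `π` is a normal proof of `M(s) = v`. -/
def IsNormalProof (s : List Bool) (v : Bool) (π : List Fm) : Prop :=
  IsProof (theory M s) π (outputIs M v)

/-- The data of an adjoint checker `CK_π` of a normal proof `π` of `M(r) = v`; `G` is the check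
sequence of the proof. (If a member of `π` can be justified in several ways, any choice is
admitted.) -/
structure AdjointChecker where
  r : List Bool
  v : Bool
  outputs : M.Outputs r v
  π : List Fm
  normal : IsNormalProof M r v π
  G : List Checker
  proofType : IsProofType (theory M r) π G

/-- The answer of the `C`-generated verifier on input `s`: is `CK_π(T_{⟨M,s⟩}, π) = 1` for some
member of `C`? -/
noncomputable def verifierValue (C : List (AdjointChecker M)) (s : List Bool) : Bool :=
  C.any fun c => CK c.G (theory M s) c.π

end Theory

/-! ## The verifier as a Turing machine -/

/-- Control flow of a verifier: answer `v`, or search for the formula `φ` in the theory of the input,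
inspecting only what concerns the first `B + 1` squares of the input, and branch. -/
inductive Prog : Type
  | ret (v : Bool)
  | search (φ : Fm) (B : ℕ) (yes no : Prog)

/-- States of the machine that answers: going back to the left end; writing the answer. -/
inductive RetState : Type
  | rewind
  | write

/-- States of the machine that searches: going back to the left end; reading the `p`-th bit. -/
inductive SearchState (B : ℕ) : Type
  | rewind
  | read (p : Fin (B + 1))

namespace Prog

/-- The states (other than the halting state) of the machine of a program. -/
def State : Prog → Type
  | ret _ => RetState
  | search _ B yes no => SearchState B ⊕ (yes.State ⊕ no.State)

/-- The first state of a program. -/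
def start : (P : Prog) → P.State
  | ret _ => RetState.rewind
  | search _ _ _ _ => Sum.inl SearchState.rewind

theorem finite_state : (P : Prog) → Finite P.State
  | ret _ => Finite.of_injective (β := Bool)
      (fun s : RetState => match s with
        | RetState.rewind => true
        | RetState.write => false) (by
        intro a b h; cases a <;> cases b <;> first | rfl | simp at h)
  | search φ B yes no => by
      have := finite_state yes
      have := finite_state no
      have : Finite (SearchState B) := Finite.of_injective (β := Option (Fin (B + 1)))
        (fun s => match s with
          | SearchState.rewind => none
          | SearchState.read p => some p) (by
          intro a b h; cases a <;> cases b <;> simp_all)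
      exact inferInstanceAs (Finite (SearchState B ⊕ (yes.State ⊕ no.State)))

/-- Transitions of the machine of a program (`none` is the halting state).  The formulas of the theory
of the input that do not depend on the input are in the finite control (`fixed`).  The other ones are
determined from the tape: if `c` is read on square `p + 1`, then `bit p c` is in the theory, and if
square `p + 1` is the first blank one, then `len p` is. -/
def next (fixed : List Fm) (len : ℕ → Fm) (bit : ℕ → Bool → Fm) :
    (P : Prog) → P.State → Sym → Option P.State × Sym × Dir
  | ret _, RetState.rewind, Sym.leftEnd => (some RetState.write, Sym.leftEnd, Dir.R)
  | ret _, RetState.rewind, a => (some RetState.rewind, a, Dir.L)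
  | ret _, RetState.write, Sym.leftEnd => (some RetState.write, Sym.leftEnd, Dir.R)
  | ret v, RetState.write, _ => (none, Sym.bit v, Dir.S)
  | search φ _ yes _, Sum.inl SearchState.rewind, Sym.leftEnd =>
      (some (if AL φ fixed then Sum.inr (Sum.inl yes.start) else Sum.inl (SearchState.read 0)),
        Sym.leftEnd, Dir.R)
  | search _ _ _ _, Sum.inl SearchState.rewind, a =>
      (some (Sum.inl SearchState.rewind), a, Dir.L)
  | search _ _ _ no, Sum.inl (SearchState.read _), Sym.leftEnd =>
      (some (Sum.inr (Sum.inr no.start)), Sym.leftEnd, Dir.R)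
  | search φ _ yes no, Sum.inl (SearchState.read p), Sym.blank =>
      (some (Sum.inr (if φ = len p then Sum.inl yes.start else Sum.inr no.start)),
        Sym.blank, Dir.S)
  | search φ B yes no, Sum.inl (SearchState.read p), Sym.bit c =>
      if φ = bit p c then (some (Sum.inr (Sum.inl yes.start)), Sym.bit c, Dir.S)
      else if h : p.val + 1 < B + 1 then
        (some (Sum.inl (SearchState.read ⟨p.val + 1, h⟩)), Sym.bit c, Dir.R)
      else (some (Sum.inr (Sum.inr no.start)), Sym.bit c, Dir.S)
  | search _ _ yes _, Sum.inr (Sum.inl q), a =>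
      let r := next fixed len bit yes q a
      (r.1.map fun q' => Sum.inr (Sum.inl q'), r.2)
  | search _ _ _ no, Sum.inr (Sum.inr q), a =>
      let r := next fixed len bit no q a
      (r.1.map fun q' => Sum.inr (Sum.inr q'), r.2)

theorem next_leftEnd (fixed : List Fm) (len : ℕ → Fm) (bit : ℕ → Bool → Fm) :
    (P : Prog) → (q : P.State) →
      (next fixed len bit P q Sym.leftEnd).2 = (Sym.leftEnd, Dir.R)
  | ret _, RetState.rewind => rfl
  | ret _, RetState.write => rfl
  | search _ _ _ _, Sum.inl SearchState.rewind => rfl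
  | search _ _ _ _, Sum.inl (SearchState.read _) => rfl
  | search _ _ yes _, Sum.inr (Sum.inl q) => next_leftEnd fixed len bit yes q
  | search _ _ _ no, Sum.inr (Sum.inr q) => next_leftEnd fixed len bit no q

theorem next_ne_leftEnd (fixed : List Fm) (len : ℕ → Fm) (bit : ℕ → Bool → Fm) :
    (P : Prog) → (q : P.State) → (a : Sym) → a ≠ Sym.leftEnd →
      (next fixed len bit P q a).2.1 ≠ Sym.leftEnd
  | ret _, RetState.rewind, a, h => by cases a <;> simp_all [next]
  | ret _, RetState.write, a, h => by cases a <;> simp_all [next]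
  | search _ _ _ _, Sum.inl SearchState.rewind, a, h => by cases a <;> simp_all [next]
  | search _ _ _ _, Sum.inl (SearchState.read _), a, h => by
      cases a
      · simp only [next]; split_ifs <;> simp
      · simp [next]
      · exact absurd rfl h
  | search _ _ yes _, Sum.inr (Sum.inl q), a, h => next_ne_leftEnd fixed len bit yes q a h
  | search _ _ _ no, Sum.inr (Sum.inr q), a, h => next_ne_leftEnd fixed len bit no q a h

/-- The Turing machine of a program. -/
def toTM (fixed : List Fm) (len : ℕ → Fm) (bit : ℕ → Bool → Fm) (P : Prog) :
    TM (Option P.State) where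
  finite := by
    have := P.finite_state
    infer_instance
  δ q a := match q with
    | none => (none, a, Dir.S)
    | some q => next fixed len bit P q a
  q₀ := some P.start
  qhalt := none
  left_end q h := by
    cases q with
    | none => exact absurd rfl h
    | some q => exact next_leftEnd fixed len bit P q
  not_left_end q a h := by
    cases q with
    | none => exact h
    | some q => exact next_ne_leftEnd fixed len bit P q a h
  halt _ := rfl
  halt_unique q h := by
    cases q with
    | none => rfl
    | some q =>
      have h1 := next_leftEnd fixed len bit P q
      have h2 : next fixed len bit P q Sym.leftEnd = (none, Sym.leftEnd, Dir.S) :=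
        h Sym.leftEnd
      rw [h2] at h1
      simp at h1

end Prog

section Verifier

variable {Q : Type} [FinEnum Q] {M : TM Q}

/-- Compute the checkers `gs` of `c` one after the other, each with its position in the sequence `π`;
go to `yes` if all of them return `1`, and to `no` as soon as one returns `0`.  A checker for
membership in the theory of the input is a search; since `π` is fixed and the searched formula is in
the theory of `c.r`, the search inspects at most the first `|r| + 1` squares of the input.  The other
checkers depend only on `π` and not on the input, so that their values are in the finite control. -/
noncomputable def checkAll (c : AdjointChecker M) : List (Checker × ℕ) → Prog → Prog → Prog
  | [], yes, _ => yes
  | (Checker.hyp, i) :: gs, yes, no =>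
      match c.π[i]? with
      | none => no
      | some φ => Prog.search φ c.r.length (checkAll c gs yes no) no
  | (g, i) :: gs, yes, no =>
      if g.eval [] c.π i then checkAll c gs yes no else no

/-- Run the adjoint checkers one after the other; answer `1` as soon as one of them accepts, and `0`
if none does. -/
noncomputable def verifierProg : List (AdjointChecker M) → Prog
  | [] => Prog.ret false
  | c :: C =>
      if c.π.length = c.G.length then
        checkAll c c.G.zipIdx (Prog.ret true) (verifierProg C)
      else verifierProg C

/-- The `C`-generated verifier `F_C`, a Turing machine. -/
noncomputable def generatedVerifier (M : TM Q) (C : List (AdjointChecker M)) :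
    TM (Option (verifierProg C).State) :=
  Prog.toTM (defM M ++ [inputStart M]) (inputLength M) (inputBit M) (verifierProg C)

end Verifier

end CKV

namespace CKV

open Fm
open TM (initTape)

/-! ## Syntactic injectivity of the formulas describing the input -/

/-! The verifier is a finite decision tree whose inner nodes are searches for one formula and whose
leaves are answers. A branch visits finitely many nodes, and each node inspects a number of squares
fixed in advance, so the running time is bounded independently of the input. The tape is not altered
before the final answer, so every search starts from the original input.

Correctness depends on whether a truncated search can miss a formula. A searched formula `φ` is a
hypothesis of a proof about `r`, so it lies in the theory of `r`. Either it does not depend on the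
input and is known to the finite control, or it is the length formula for `|r|` or a bit formula
with position below `|r|`. These formulas are syntactically injective in their numeral, and no
length formula is a bit formula. If `φ` also belongs to the theory of `s`, it must therefore occur
there with the same numeral, and squares `1, …, |r| + 1` suffice to find it
(`mem_theory_iff_foundFrom`).

All other checkers ignore the theory, so their verdicts can be fixed in advance
(`progValue_checkAll`). The machine side is `exists_iterate_step`: by induction on the tree, the
machine reaches the prescribed answer within `time` plus its initial head position. The head
position has to be carried along because each search begins by rewinding from wherever the previous
one stopped. -/

theorem isNum_injective (b : ℕ) (y : Tm) : Function.Injective fun n => isNum n b y := by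
  intro n
  induction n generalizing b y with
  | zero =>
    intro m h
    cases m with
    | zero => rfl
    -- The formula for zero begins with a universal quantifier, the one for a successor with a
    -- negation.
    | succ m => simp [isNum, isEmpty, ex] at h
  | succ n ih =>
    intro m h
    cases m with
    | zero => simp [isNum, isEmpty, ex] at h
    | succ m =>
      simp only [isNum, ex, Fm.and, Fm.neg.injEq, Fm.all.injEq, Fm.imp.injEq, true_and, and_true] at h
      rw [ih _ _ h]

/-- The bodies may differ, so the numeral can be recovered from a bit formula without knowing which
bit it asserts. -/
theorem letNum_left_injective {k n m : ℕ} {α β : Fm} (h : letNum k n α = letNum k m β) :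
    n = m := by
  simp only [letNum, ex, Fm.and, Fm.neg.injEq, Fm.all.injEq, Fm.imp.injEq, true_and] at h
  exact isNum_injective _ _ h.1

section Input

variable {Q : Type} [FinEnum Q] (M : TM Q)

theorem inputLength_injective : Function.Injective (inputLength M) := by
  intro n m h
  simp only [inputLength, allNat, Fm.all.injEq, Fm.imp.injEq, true_and, and_true] at h
  exact letNum_left_injective h

theorem inputBit_left_injective {p p' : ℕ} {c c' : Bool}
    (h : inputBit M p c = inputBit M p' c') : p = p' := by
  -- Only the outer `letNum`, on variable `0`, is unfolded; the inner one carries `p + 1` and is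
  -- left intact for `letNum_left_injective`.
  rw [inputBit, inputBit, letNum.eq_def 0, letNum.eq_def 0] at h
  simp only [ex, Fm.and, Fm.neg.injEq, Fm.all.injEq, Fm.imp.injEq, true_and] at h
  exact Nat.succ.inj (letNum_left_injective h)

/-- The outermost symbols differ: a universal quantifier against the negation that begins an
existential formula. -/
theorem inputLength_ne_inputBit (n p : ℕ) (c : Bool) : inputLength M n ≠ inputBit M p c := by
  simp [inputLength, inputBit, allNat, letNum, ex]

end Input

theorem AL_eq_true_iff {φ : Fm} {T : List Fm} : AL φ T = true ↔ φ ∈ T := by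
  induction T with
  | nil => simp [AL]
  | cons ψ T ih => by_cases h : φ = ψ <;> simp [AL, h, ih]

/-! ## Runs of program machines -/

/-- Rename the state of a configuration. -/
def Cfg.map {Q Q' : Type} (f : Q → Q') (c : Cfg Q) : Cfg Q' := ⟨f c.state, c.head, c.tape⟩

theorem initTape_succ_ne_leftEnd (s : List Bool) (p : ℕ) : initTape s (p + 1) ≠ Sym.leftEnd := by
  simp only [initTape]
  split <;> simp

/-- A step that does not change the tape. -/
theorem TM.step_of_δ {Q : Type} (N : TM Q) {q q' : Q} {h : ℕ} {t : ℕ → Sym} {a : Sym} {d : Dir}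
    (ha : t h = a) (e : N.δ q a = (q', a, d)) : N.step ⟨q, h, t⟩ = ⟨q', d.move h, t⟩ := by
  subst ha
  simp [TM.step, e]

namespace Prog

variable (fixed : List Fm) (len : ℕ → Fm) (bit : ℕ → Bool → Fm)

/-- `φ` is found among the formulas read from the squares `p + 1, …, B + 1` of the input `s`. -/
def FoundFrom (φ : Fm) (B : ℕ) (s : List Bool) (p : ℕ) : Prop :=
  ∃ m, p ≤ m ∧ m ≤ B ∧ ((∃ c, s[m]? = some c ∧ φ = bit m c) ∨ (m = s.length ∧ φ = len m))

open Classical in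
/-- The answer of the machine of a program on input `s`. -/
noncomputable def value (s : List Bool) : Prog → Bool
  | ret v => v
  | search φ B yes no =>
      if φ ∈ fixed ∨ FoundFrom len bit φ B s 0 then value s yes else value s no

/-- A bound for the number of steps of the machine of a program, when started on square `0`. -/
def time : Prog → ℕ
  | ret _ => 2
  | search _ B yes no => 2 * B + 4 + max yes.time no.time

/-- The machine of a subprogram sits inside the large machine with its states relabelled, and its
halting state is the common halting state. Complete runs, including the halt, therefore transfer
from the subprogram. -/
theorem map_step_yes (φ : Fm) (B : ℕ) (yes no : Prog) :
    Function.Semiconj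
      (Cfg.map (Option.map fun q => (Sum.inr (Sum.inl q) : (search φ B yes no).State)))
      (toTM fixed len bit yes).step (toTM fixed len bit (search φ B yes no)).step := by
  rintro ⟨_ | q, h, t⟩ <;> rfl

theorem map_step_no (φ : Fm) (B : ℕ) (yes no : Prog) :
    Function.Semiconj
      (Cfg.map (Option.map fun q => (Sum.inr (Sum.inr q) : (search φ B yes no).State)))
      (toTM fixed len bit no).step (toTM fixed len bit (search φ B yes no)).step := by
  rintro ⟨_ | q, h, t⟩ <;> rfl

theorem iterate_rewind {Q : Type} (N : TM Q) (q : Q)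
    (hq : ∀ a, a ≠ Sym.leftEnd → N.δ q a = (q, a, Dir.L)) (s : List Bool) (h : ℕ) :
    N.step^[h] ⟨q, h, initTape s⟩ = ⟨q, 0, initTape s⟩ := by
  induction h with
  | zero => rfl
  | succ h ih =>
    rw [Function.iterate_succ_apply]
    rw [N.step_of_δ rfl (hq _ (initTape_succ_ne_leftEnd s h))]
    exact ih

open Classical in
-- Induction on the number `k` of bits still allowed after position `p`. The invariant `p ≤
-- s.length` says that no blank has been passed, so a blank on square `p + 1` is the first one and
-- forces `p = s.length`. The bound on the final head position controls the cost of the next rewind.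
theorem exists_iterate_read (φ : Fm) (B : ℕ) (yes no : Prog) (s : List Bool) (k : ℕ) :
    ∀ (p : ℕ) (hp : p < B + 1), p + k = B → p ≤ s.length →
    ∃ n ≤ k + 1, ∃ h ≤ B + 1, (toTM fixed len bit (search φ B yes no)).step^[n]
        ⟨some (Sum.inl (SearchState.read ⟨p, hp⟩)), p + 1, initTape s⟩ =
      ⟨some (Sum.inr (if FoundFrom len bit φ B s p then Sum.inl yes.start
        else Sum.inr no.start)), h, initTape s⟩ := by
  induction k with
  | zero =>
    intro p hp hk hs
    refine ⟨1, by omega, p + 1, by omega, ?_⟩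
    obtain rfl : p = B := by omega
    -- At the last permitted position the range of `m` is the single value `p`.
    have hF : FoundFrom len bit φ p s p ↔
        ((∃ c, s[p]? = some c ∧ φ = bit p c) ∨ (p = s.length ∧ φ = len p)) := by
      constructor
      · rintro ⟨m, h1, h2, h3⟩
        obtain rfl : m = p := by omega
        exact h3
      · exact fun h => ⟨p, le_rfl, le_rfl, h⟩
    rw [if_congr hF rfl rfl]
    rcases hc : s[p]? with _ | c
    · have hl : p = s.length := le_antisymm hs (by simpa using hc)
      have ht : initTape s (p + 1) = Sym.blank := by simp [initTape, hc]
      exact TM.step_of_δ _ ht (d := Dir.S) (by simp [toTM, next, ← hl])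
    · have hl : p ≠ s.length := by rintro rfl; simp at hc
      have ht : initTape s (p + 1) = Sym.bit c := by simp [initTape, hc]
      refine TM.step_of_δ _ ht (d := Dir.S) ?_
      by_cases hb : φ = bit p c <;> simp [toTM, next, hl, hb]
  | succ k ih =>
    intro p hp hk hs
    rcases hc : s[p]? with _ | c
    · refine ⟨1, by omega, p + 1, by omega, ?_⟩
      have hl : p = s.length := le_antisymm hs (by simpa using hc)
      have ht : initTape s (p + 1) = Sym.blank := by simp [initTape, hc]
      -- Past the end of the input there are no bits, so only the length formula can still be found.
      have hF : FoundFrom len bit φ B s p ↔ φ = len p := by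
        constructor
        · rintro ⟨m, h1, h2, ⟨c, h3, -⟩ | ⟨h3, h4⟩⟩
          · obtain ⟨h, -⟩ := List.getElem?_eq_some_iff.1 h3
            omega
          · rwa [hl, ← h3]
        · exact fun h => ⟨p, le_rfl, by omega, Or.inr ⟨hl, h⟩⟩
      rw [if_congr hF rfl rfl]
      exact TM.step_of_δ _ ht (d := Dir.S) (by simp [toTM, next])
    · have hl : p < s.length := (List.getElem?_eq_some_iff.1 hc).1
      have ht : initTape s (p + 1) = Sym.bit c := by simp [initTape, hc]
      by_cases hb : φ = bit p c
      · refine ⟨1, by omega, p + 1, by omega, ?_⟩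
        rw [if_pos ⟨p, le_rfl, by omega, Or.inl ⟨c, hc, hb⟩⟩]
        exact TM.step_of_δ _ ht (d := Dir.S) (by simp [toTM, next, ← hb])
      -- Position `p` holds the bit `c`, whose formula is not `φ`, and is not the end of the input;
      -- the search can pass to `p + 1`.
      · have hF : FoundFrom len bit φ B s p ↔ FoundFrom len bit φ B s (p + 1) := by
          constructor
          · rintro ⟨m, h1, h2, h3⟩
            refine ⟨m, lt_of_le_of_ne h1 ?_, h2, h3⟩
            rintro rfl
            rcases h3 with ⟨c', h3, h4⟩ | ⟨h3, -⟩
            · rw [hc] at h3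
              exact hb (Option.some.inj h3 ▸ h4)
            · omega
          · rintro ⟨m, h1, h2, h3⟩
            exact ⟨m, by omega, h2, h3⟩
        obtain ⟨n, hn, h, hh, e⟩ := ih (p + 1) (by omega) (by omega) hl
        refine ⟨n + 1, by omega, h, hh, ?_⟩
        rw [if_congr hF rfl rfl, ← e, Function.iterate_succ_apply]
        congr 1
        have hp' : p + 1 < B + 1 := by omega
        exact TM.step_of_δ _ ht (d := Dir.R) (by simp [toTM, next, hb, hp'])

open Classical in
theorem exists_iterate_search (φ : Fm) (B : ℕ) (yes no : Prog) (s : List Bool) (h : ℕ) :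
    ∃ n ≤ h + B + 2, ∃ h' ≤ B + 1, (toTM fixed len bit (search φ B yes no)).step^[n]
        ⟨some (search φ B yes no).start, h, initTape s⟩ =
      ⟨some (Sum.inr (if φ ∈ fixed ∨ FoundFrom len bit φ B s 0 then Sum.inl yes.start
        else Sum.inr no.start)), h', initTape s⟩ := by
  have hrew := iterate_rewind (toTM fixed len bit (search φ B yes no))
    (some (search φ B yes no).start)
    (fun a ha => by cases a <;> first | rfl | exact absurd rfl ha) s h
  have ht : initTape s 0 = Sym.leftEnd := rfl
  by_cases hf : φ ∈ fixed
  -- After `h` rewinding steps, the single step on the left end marker already branches on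
  -- membership in `fixed`.
  · refine ⟨1 + h, by omega, 1, by omega, ?_⟩
    rw [Function.iterate_add_apply, hrew]
    have hAL := AL_eq_true_iff.2 hf
    rw [if_pos (Or.inl hf)]
    exact TM.step_of_δ _ ht (d := Dir.R)
      (congrArg (fun q => (some q, Sym.leftEnd, Dir.R)) (if_pos hAL))
  · obtain ⟨n, hn, h', hh', e⟩ :=
      exists_iterate_read fixed len bit φ B yes no s B 0 (by omega) (by omega) (by omega)
    refine ⟨n + (1 + h), by omega, h', hh', ?_⟩
    rw [Function.iterate_add_apply, Function.iterate_add_apply, hrew]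
    simp only [hf, false_or]
    rw [← e]
    congr 1
    have hAL : ¬ AL φ fixed = true := fun h => hf (AL_eq_true_iff.1 h)
    exact TM.step_of_δ _ ht (d := Dir.R)
      (congrArg (fun q => (some q, Sym.leftEnd, Dir.R)) (if_neg hAL))

/-- The head position `h` is arbitrary because the induction hypothesis is applied where a search
happens to stop. The tape is still `initTape s` there. -/
theorem exists_iterate_step (s : List Bool) (P : Prog) (h : ℕ) :
    ∃ n ≤ P.time + h, (toTM fixed len bit P).step^[n] ⟨some P.start, h, initTape s⟩ =
      ⟨none, 1, Function.update (initTape s) 1 (Sym.bit (P.value fixed len bit s))⟩ := by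
  induction P generalizing h with
  | ret v =>
    -- There are `h` steps back to square `0`, one step to square `1`, and one step to write the
    -- answer.
    refine ⟨1 + (1 + h), by simp only [time]; omega, ?_⟩
    rw [Function.iterate_add_apply, Function.iterate_add_apply,
      iterate_rewind _ _ (fun a ha => by cases a <;> first | rfl | exact absurd rfl ha)]
    have ht : initTape s 0 = Sym.leftEnd := rfl
    have e : (toTM fixed len bit (ret v)).step ⟨some (ret v).start, 0, initTape s⟩ =
        ⟨some RetState.write, 1, initTape s⟩ :=
      TM.step_of_δ _ ht (d := Dir.R) rfl
    rw [Function.iterate_one, e]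
    have h1 := initTape_succ_ne_leftEnd s 0
    rw [zero_add] at h1
    rcases h2 : initTape s 1 with b | _ | _
    · simp [TM.step, toTM, next, h2, Dir.move, value]
    · simp [TM.step, toTM, next, h2, Dir.move, value]
    · exact absurd h2 h1
  | search φ B yes no ihy ihn =>
    obtain ⟨n, hn, h', hh', e⟩ := exists_iterate_search fixed len bit φ B yes no s h
    by_cases hF : φ ∈ fixed ∨ FoundFrom len bit φ B s 0
    · obtain ⟨m, hm, e'⟩ := ihy h'
      -- The search takes at most `h + B + 2` steps and leaves the head at `h' ≤ B + 1`, which is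
      -- added to the time of the subprogram; the total `h + 2 * B + 3` plus that time is within the
      -- bound.
      refine ⟨m + n, by simp only [time]; omega, ?_⟩
      rw [Function.iterate_add_apply, e, if_pos hF]
      have := (map_step_yes fixed len bit φ B yes no).iterate_right m
        ⟨some yes.start, h', initTape s⟩
      rw [e'] at this
      simp only [value, if_pos hF]
      exact this.symm
    · obtain ⟨m, hm, e'⟩ := ihn h'
      refine ⟨m + n, by simp only [time]; omega, ?_⟩
      rw [Function.iterate_add_apply, e, if_neg hF]
      have := (map_step_no fixed len bit φ B yes no).iterate_right m
        ⟨some no.start, h', initTape s⟩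
      rw [e'] at this
      simp only [value, if_neg hF]
      exact this.symm

end Prog

/-! ## Correctness of the verifier's program -/

section Verifier

variable {Q : Type} [FinEnum Q] {M : TM Q}

theorem mem_theory_iff {s : List Bool} {φ : Fm} :
    φ ∈ theory M s ↔ φ ∈ defM M ++ [inputStart M] ∨ φ = inputLength M s.length ∨
      ∃ p c, s[p]? = some c ∧ φ = inputBit M p c := by
  simp only [theory, inputM, List.mem_append, List.mem_cons, List.mem_map, Prod.exists,
    List.mem_zipIdx_iff_getElem?, List.not_mem_nil, or_false]
  constructor
  · rintro (h | h | h | ⟨c, p, h, rfl⟩)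
    · exact Or.inl (Or.inl h)
    · exact Or.inr (Or.inl h)
    · exact Or.inl (Or.inr h)
    · exact Or.inr (Or.inr ⟨p, c, h, rfl⟩)
  · rintro ((h | h) | h | ⟨p, c, h, rfl⟩)
    · exact Or.inl h
    · exact Or.inr (Or.inr (Or.inl h))
    · exact Or.inr (Or.inl h)
    · exact Or.inr (Or.inr (Or.inr ⟨c, p, h, rfl⟩))

/-- For a formula in the theory of `r`, inspecting `|r| + 1` squares of `s` decides membership in the
theory of `s`. -/
theorem mem_theory_iff_foundFrom {r s : List Bool} {φ : Fm} (hr : φ ∈ theory M r) :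
    φ ∈ theory M s ↔ φ ∈ defM M ++ [inputStart M] ∨
      Prog.FoundFrom (inputLength M) (inputBit M) φ r.length s 0 := by
  rw [mem_theory_iff]
  -- Outside the fixed part, `φ` is the length formula or a bit formula of `r`, which determines its
  -- numeral.
  refine or_congr_right' fun hfix => ?_
  have hr' := (mem_theory_iff.1 hr).resolve_left hfix
  constructor
  · rintro (h | ⟨p, c, hp, h⟩)
    · refine ⟨s.length, by omega, ?_, Or.inr ⟨rfl, h⟩⟩
      -- If `φ` is the length formula for `|s|`, it is also that for `|r|`, so `|s| = |r|` and the
      -- end of `s` is within the inspected range.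
      rcases hr' with h' | ⟨p, c, -, h'⟩
      · exact (inputLength_injective M (h.symm.trans h')).le
      · exact absurd (h.symm.trans h') (inputLength_ne_inputBit M _ _ _)
    · refine ⟨p, by omega, ?_, Or.inl ⟨c, hp, h⟩⟩
      rcases hr' with h' | ⟨p', c', hp', h'⟩
      · exact absurd (h'.symm.trans h) (inputLength_ne_inputBit M _ _ _)
      · obtain rfl := inputBit_left_injective M (h.symm.trans h')
        exact (List.getElem?_eq_some_iff.1 hp').1.le
  · rintro ⟨m, -, -, ⟨c, hc, h⟩ | ⟨rfl, h⟩⟩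
    · exact Or.inr ⟨m, c, hc, h⟩
    · exact Or.inl h

/-- The value of a program over the formulas of the theory of the input. -/
noncomputable abbrev progValue (M : TM Q) (s : List Bool) (P : Prog) : Bool :=
  P.value (defM M ++ [inputStart M]) (inputLength M) (inputBit M) s

/-- The hypothesis that all checkers accept for `c.r` is what puts every searched formula in the
theory of `c.r`, so that the cut-off at `c.r.length` is harmless. -/
theorem progValue_checkAll (c : AdjointChecker M) (s : List Bool) (yes no : Prog) :
    ∀ gs : List (Checker × ℕ), (∀ p ∈ gs, p.1.eval (theory M c.r) c.π p.2 = true) →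
    progValue M s (checkAll c gs yes no) =
      if (gs.all fun p => p.1.eval (theory M s) c.π p.2) = true then progValue M s yes
      else progValue M s no := by
  intro gs
  induction gs with
  | nil => intro; simp [checkAll]
  | cons p gs ih =>
    intro H
    have ih := ih fun p hp => H p (List.mem_cons_of_mem _ hp)
    have hp := H p List.mem_cons_self
    obtain ⟨g, i⟩ := p
    -- This covers all checkers except `hyp`: their values do not use the theory, so the premise
    -- will hold by `rfl`.
    have hother : g.eval [] c.π i = g.eval (theory M s) c.π i →
        progValue M s (if g.eval [] c.π i then checkAll c gs yes no else no) =
        if (((g, i) :: gs).all fun p => p.1.eval (theory M s) c.π p.2) = true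
        then progValue M s yes else progValue M s no := by
      intro h
      rw [List.all_cons, ← h]
      by_cases h1 : g.eval [] c.π i = true
      · rw [if_pos h1, h1, Bool.true_and, ih]
      · simp [h1]
    cases g with
    | hyp =>
      rcases hφ : c.π[i]? with _ | φ
      -- A position outside `π` would make the checker reject, contrary to its acceptance for `c.r`.
      · simp [Checker.eval, hφ] at hp
      · simp only [Checker.eval, hφ, AL_eq_true_iff] at hp
        have hm := mem_theory_iff_foundFrom (s := s) hp
        simp only [checkAll, hφ, progValue, Prog.value, ← hm]
        simp only [progValue] at ih
        by_cases hs : φ ∈ theory M s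
        · have he : Checker.hyp.eval (theory M s) c.π i = true := by
            simpa [Checker.eval, hφ] using AL_eq_true_iff.2 hs
          rw [if_pos hs, ih, List.all_cons, he, Bool.true_and]
        · have he : Checker.hyp.eval (theory M s) c.π i = false := by
            simpa [Checker.eval, hφ] using mt AL_eq_true_iff.1 hs
          rw [if_neg hs, List.all_cons, he, Bool.false_and, if_neg Bool.false_ne_true]
    | logic => exact hother rfl
    | zfc => exact hother rfl
    | mp j k => exact hother rfl
    | gen j k => exact hother rfl

theorem progValue_verifierProg (s : List Bool) (C : List (AdjointChecker M)) :
    progValue M s (verifierProg C) = verifierValue M C s := by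
  induction C with
  | nil => rfl
  | cons c C ih =>
    have hlen := c.proofType.1
    -- The length test always succeeds, because a check sequence is as long as its proof.
    rw [verifierProg, if_pos hlen.symm, progValue_checkAll]
    · rw [ih]
      simp only [verifierValue, List.any_cons, CK, hlen, decide_true, Bool.true_and]
      cases (c.G.zipIdx.all fun p => p.1.eval (theory M s) c.π p.2) <;> rfl
    · rintro ⟨g, i⟩ h
      exact c.proofType.2 i g (List.mem_zipIdx_iff_getElem?.1 h)

theorem exists_run_generatedVerifier (C : List (AdjointChecker M)) (s : List Bool) :
    ∃ n ≤ (verifierProg C).time, (generatedVerifier M C).run s n =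
      ⟨none, 1, Function.update (initTape s) 1 (Sym.bit (verifierValue M C s))⟩ := by
  rw [← progValue_verifierProg]
  exact Prog.exists_iterate_step _ _ _ s (verifierProg C) 0

end Verifier

end CKV

/-! ### Answer and uniform time bound of the verifier. -/

theorem mainTheorem6 {Q : Type} [FinEnum Q] (M : CKV.TM Q) (C : List (CKV.AdjointChecker M)) :
    (∀ s : List Bool,
      (CKV.generatedVerifier M C).Outputs s (CKV.verifierValue M C s)) ∧
    ∃ K : ℕ, ∀ s : List Bool,
      (CKV.generatedVerifier M C).timeComplexity s.length < K := by
  constructor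
  · intro s
    obtain ⟨n, -, e⟩ := CKV.exists_run_generatedVerifier C s
    refine ⟨n, ?_, ?_, ?_⟩ <;> rw [e]
    · rfl
    · simp
  -- The bound `time` depends on the program alone; the added `1` makes the inequality strict.
  · refine ⟨(CKV.verifierProg C).time + 1, fun s => Nat.lt_succ_of_le (Finset.sup_le ?_)⟩
    intro w _
    obtain ⟨n, hn, e⟩ := CKV.exists_run_generatedVerifier C (List.ofFn w)
    -- The number of steps is the least halting time, so any one halting time bounds it.
    refine (Nat.sInf_le ?_).trans hn
    exact congrArg CKV.Cfg.state e
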